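/- Let $(E_0,(\cdot|\cdot))$ be a real or complex Hilbert space and let $A$ be a closed, densely defined, self-adjoint operator on $E_0$ with compact resolvent which is bounded above by some $\alpha\in\mathbb R$, i.e. $(Ax|x)\le\alpha\|x\|^2$ for $x\in\mathrm{dom}(A)$. Then $A$ generates a strongly continuous semigroup $(e^{tA})_{t\ge0}$ on $E_0$, and its spectrum $\sigma(A)$ consists of countably many real eigenvalues of finite multiplicity $\alpha\ge\lambda_1\ge\lambda_2\ge\cdots$ (listed according to multiplicity; $\lambda_j\to-\infty$ if $\dim E_0=\infty$, and the list is finite if $\dim E_0<\infty$). Let $T>0$; the integrals $\int_0^T b(t)e^{tA}\,dt$ below converge as Bochner integrals in the space of bounded operators on $E_0$, and $\sigma_p$ denotes the point spectrum (the set of eigenvalues). (a) Let $a\in\mathbb R$, $b\in C([0,T],\mathbb R)$ and $\Phi_T:=a\,e^{TA}+\int_0^T b(t)\,e^{tA}\,dt$. Then $\ker\Phi_T=\{0\}$ if and only if $$-a\ne\int_0^T b(t)\,e^{-\lambda_j(T-t)}\,dt\quad\text{for all } j.$$ In particular, if $b\ge0$, then $\ker\Phi_T=\{0\}$ whenever either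 $a\ge0$ and $b(0)>0$, or $\alpha\le0$ and $\int_0^T b(t)\,dt>-a$. (b) Let $b\in\mathbb R\setminus\{0\}$. Then $1\notin b\,e^{T\sigma(A)}:=\{b\,e^{Tz} : z\in\sigma(A)\}$ if and only if $1\ne b\,e^{\lambda_jT}$ for all $j$. In particular, $1\notin b\,e^{T\sigma(A)}$ whenever $b\le1$ and $\alpha<0$. (c) Let $b\in C([0,T],\mathbb R)$. Then $-1\notin\sigma_p\big(\int_0^T b(t)\,e^{tA}\,dt\big)$ if and only if $$-1\ne\int_0^T b(t)\,e^{\lambda_jt}\,dt\quad\text{for all } j.$$ In particular, $-1\notin\sigma_p\big(\int_0^T b(t)\,e^{tA}\,dt\big)$ whenever $b\ge0$. -/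

import Mathlib

open MeasureTheory Filter Topology Set

noncomputable section

namespace NonlocalEvolution

variable {𝕜 E : Type*} [RCLike 𝕜] [NormedAddCommGroup E] [InnerProductSpace 𝕜 E]

/-- `R` is the bounded inverse `(z - A)⁻¹` of `z - A : dom A → E`. -/
def IsResolventAt (A : E →ₗ.[𝕜] E) (z : 𝕜) (R : E →L[𝕜] E) : Prop :=
  (∀ y : E, ∃ h : R y ∈ A.domain, z • R y - A ⟨R y, h⟩ = y) ∧
    ∀ x : A.domain, R (z • (x : E) - A x) = x

/-- The resolvent set of an unbounded operator. -/
def resolventSet (A : E →ₗ.[𝕜] E) : Set 𝕜 :=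
  {z | ∃ R : E →L[𝕜] E, IsResolventAt A z R}

/-- The spectrum of an unbounded operator. -/
def spectrum (A : E →ₗ.[𝕜] E) : Set 𝕜 := (resolventSet A)ᶜ

/-- The resolvent set is non-empty and some resolvent operator is compact
(by the resolvent identity, then all of them are). -/
def HasCompactResolvent (A : E →ₗ.[𝕜] E) : Prop :=
  ∃ (z : 𝕜) (R : E →L[𝕜] E), IsResolventAt A z R ∧ IsCompactOperator R

/-- `A ≤ α` in the sense of quadratic forms on the domain of `A`. -/
def BoundedAboveBy (A : E →ₗ.[𝕜] E) (α : ℝ) : Prop :=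
  ∀ x : A.domain, RCLike.re (inner 𝕜 (A x) (x : E)) ≤ α * ‖(x : E)‖ ^ 2

/-- `ker (A - μ)`: all `x` in the domain of `A` with `A x = μ x`. -/
def eigenspace (A : E →ₗ.[𝕜] E) (μ : 𝕜) : Submodule 𝕜 E :=
  A.graph.comap (LinearMap.prod LinearMap.id (μ • LinearMap.id))

/-- The family `lam`, indexed by the first `N ≤ ∞` natural numbers, lists the eigenvalues of `A`
in non-increasing order, each one repeated according to its multiplicity, and tends to `-∞` if
it is infinite. (The index set is finite exactly if the space is finite-dimensional; convergence
along the cofinite filter is automatic in that case.) -/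
structure IsEigenvalueEnumeration (A : E →ₗ.[𝕜] E) (N : ℕ∞)
    (lam : {j : ℕ // (j : ℕ∞) < N} → ℝ) : Prop where
  antitone : Antitone lam
  tendsto : Tendsto lam cofinite atBot
  multiplicity : ∀ μ : 𝕜,
    {j | ((lam j : ℝ) : 𝕜) = μ}.encard = Cardinal.toENat (Module.rank 𝕜 (eigenspace A μ))

/-- `S` restricted to `[0, ∞)` is a strongly continuous semigroup of bounded operators. -/
structure IsC0Semigroup (S : ℝ → E →L[𝕜] E) : Prop where
  zero : S 0 = 1
  add : ∀ s t : ℝ, 0 ≤ s → 0 ≤ t → S (s + t) = S s * S t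
  continuousOn : ∀ x : E, ContinuousOn (fun t => S t x) (Ici 0)

/-- `A` is the infinitesimal generator of `S`: `x ∈ dom A` with `A x = y` if and only if
`(S h x - x) / h → y` as `h → 0+`. -/
def IsGenerator (A : E →ₗ.[𝕜] E) (S : ℝ → E →L[𝕜] E) : Prop :=
  ∀ x y : E, (x, y) ∈ A.graph ↔
    Tendsto (fun h : ℝ => ((h⁻¹ : ℝ) : 𝕜) • (S h x - x)) (𝓝[>] 0) (𝓝 y)

open Classical in
/-- The operators `e^{tA}`, `t ≥ 0`: the strongly continuous semigroup generated by `A`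
(and `0` if `A` is not a generator; values at `t < 0` carry no meaning). -/
def opExp (A : E →ₗ.[𝕜] E) : ℝ → E →L[𝕜] E :=
  if h : ∃ S : ℝ → E →L[𝕜] E, IsC0Semigroup S ∧ IsGenerator A S then h.choose else 0

/-- The Bochner integral `∫₀ᵀ b(t) e^{tA} dt` in the space of bounded operators. -/
def averagedSemigroup (A : E →ₗ.[𝕜] E) (T : ℝ) (b : ℝ → ℝ) : E →L[𝕜] E :=
  letI : NormedSpace ℝ (E →L[𝕜] E) := NormedSpace.restrictScalars ℝ 𝕜 (E →L[𝕜] E)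
  ∫ t in (0 : ℝ)..T, ((b t : ℝ) : 𝕜) • opExp A t

/-- `Φ_T = a e^{TA} + ∫₀ᵀ b(t) e^{tA} dt`. -/
def Phi (A : E →ₗ.[𝕜] E) (T a : ℝ) (b : ℝ → ℝ) : E →L[𝕜] E :=
  (a : 𝕜) • opExp A T + averagedSemigroup A T b

/-- The set `b e^{T σ(A)}`. -/
def scaledExpSpectrum (A : E →ₗ.[𝕜] E) (T b : ℝ) : Set 𝕜 :=
  (fun z : 𝕜 => (b : 𝕜) * NormedSpace.exp ((T : 𝕜) * z)) '' spectrum A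

/-- The point spectrum (set of eigenvalues) of a bounded operator. -/
def pointSpectrum (B : E →L[𝕜] E) : Set 𝕜 :=
  {z | Module.End.HasEigenvalue (B : E →ₗ[𝕜] E) z}

end NonlocalEvolution

end

/-!
Above `α` no real number is an eigenvalue of `A`, so by the Fredholm alternative the resolvent
exists and is compact at `α + 1`; being symmetric there, it is diagonal in a Hilbert basis `e`, with
positive entries tending to zero. Hence `A` is multiplication by a real family `λ_i → -∞` in the
coordinates of `e`, its spectrum is the set of the `λ_i`, and the multiplicity of an eigenvalue is
the number of indices at which it occurs. The operators with entries `e^{tλ_i}` form a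
`C₀`-semigroup with generator `A`. For any other such semigroup `S` the function `t ↦ S t (e i)`
solves `u' = λ_i u`, so `opExp A`, although it is chosen arbitrarily, is this one. Bochner
integration acts entrywise on diagonal operators, and thus `∫₀ᵀ b(t) e^{tA} dt` has the entries
`∫₀ᵀ b(t) e^{tλ_i} dt`. Kernels and eigenvalues can then be read off the entries.
-/

namespace NonlocalEvolution

variable {𝕜 E ι : Type*} [RCLike 𝕜] [NormedAddCommGroup E] [InnerProductSpace 𝕜 E]

section Coordinates

variable (e : HilbertBasis ι 𝕜 E)

theorem hasSum_norm_inner_sq (x : E) : HasSum (fun i => ‖inner 𝕜 (e i) x‖ ^ 2) (‖x‖ ^ 2) := by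
  have h := RCLike.hasSum_re 𝕜 (e.hasSum_inner_mul_inner x x)
  rw [inner_self_eq_norm_sq] at h
  refine h.congr_fun fun i => ?_
  rw [← inner_conj_symm x (e i), RCLike.conj_mul]
  norm_cast

theorem ext_inner_hilbertBasis {x y : E} (h : ∀ i, inner 𝕜 (e i) x = inner 𝕜 (e i) y) :
    x = y := by
  apply e.repr.injective
  ext i
  rw [e.repr_apply_apply, e.repr_apply_apply, h]

theorem exists_forall_inner_eq {c : ι → 𝕜} (hc : Summable fun i => ‖c i‖ ^ 2) :
    ∃ y : E, ∀ i, inner 𝕜 (e i) y = c i := by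
  have hmem : Memℓp c 2 := memℓp_gen (by simpa using hc)
  exact ⟨e.repr.symm ⟨c, hmem⟩, fun i => by rw [← e.repr_apply_apply]; simp⟩

theorem inner_hilbertBasis_eq_zero {i j : ι} (h : i ≠ j) : inner 𝕜 (e i) (e j) = 0 :=
  e.orthonormal.2 h

theorem norm_le_of_norm_inner_le {x y : E} {C : ℝ} (hC : 0 ≤ C)
    (h : ∀ i, ‖inner 𝕜 (e i) y‖ ≤ C * ‖inner 𝕜 (e i) x‖) : ‖y‖ ≤ C * ‖x‖ := by
  refine le_of_sq_le_sq ?_ (by positivity)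
  rw [mul_pow]
  refine hasSum_le (fun i => ?_) (hasSum_norm_inner_sq e y)
    ((hasSum_norm_inner_sq e x).mul_left (C ^ 2))
  rw [← mul_pow]
  exact pow_le_pow_left₀ (norm_nonneg _) (h i) 2

theorem tendsto_of_tendsto_inner_of_dominated {β : Type*} {l : Filter β} {f : β → E} {y z : E}
    {C : ℝ} (hlim : ∀ i, Tendsto (fun n => inner 𝕜 (e i) (f n)) l (𝓝 (inner 𝕜 (e i) y)))
    (hbound : ∀ᶠ n in l, ∀ i, ‖inner 𝕜 (e i) (f n)‖ ≤ C * ‖inner 𝕜 (e i) z‖) :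
    Tendsto f l (𝓝 y) := by
  rcases l.eq_or_neBot with rfl | _
  · exact tendsto_bot
  have hy (i : ι) : ‖inner 𝕜 (e i) y‖ ≤ C * ‖inner 𝕜 (e i) z‖ :=
    le_of_tendsto (hlim i).norm (hbound.mono fun n hn => hn i)
  have hsum : Tendsto (fun n => ∑' i, ‖inner 𝕜 (e i) (f n - y)‖ ^ 2) l
      (𝓝 (∑' _ : ι, (0 : ℝ))) := by
    refine tendsto_tsum_of_dominated_convergence
      ((hasSum_norm_inner_sq e z).summable.mul_left ((2 * C) ^ 2)) (fun i => ?_) ?_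
    · have : Tendsto (fun n => inner 𝕜 (e i) (f n - y)) l (𝓝 0) := by
        simpa [inner_sub_right] using (hlim i).sub_const (inner 𝕜 (e i) y)
      simpa using this.norm.pow 2
    · filter_upwards [hbound] with n hn i
      rw [← mul_pow, Real.norm_of_nonneg (by positivity), inner_sub_right]
      refine pow_le_pow_left₀ (norm_nonneg _) ((norm_sub_le _ _).trans ?_) 2
      linarith [hn i, hy i]
  simp only [(hasSum_norm_inner_sq e _).tsum_eq, tsum_zero] at hsum
  rw [tendsto_iff_norm_sub_tendsto_zero]
  simpa [Function.comp_def, Real.sqrt_sq (norm_nonneg _)] using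
    (Real.continuous_sqrt.tendsto 0).comp hsum

end Coordinates

/-- The bounded operator `D` is diagonal in the Hilbert basis `e`, with diagonal entries `m`. -/
def IsDiagonal (e : HilbertBasis ι 𝕜 E) (D : E →L[𝕜] E) (m : ι → 𝕜) : Prop :=
  ∀ i, D (e i) = m i • e i

section Diagonal

variable {e : HilbertBasis ι 𝕜 E} {D : E →L[𝕜] E} {m : ι → 𝕜}

theorem isDiagonal_iff_inner :
    IsDiagonal e D m ↔ ∀ x i, inner 𝕜 (e i) (D x) = m i * inner 𝕜 (e i) x := by
  constructor
  · intro hD x i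
    suffices (innerSL 𝕜 (e i)).comp D = m i • innerSL 𝕜 (e i) by
      simpa using DFunLike.congr_fun this x
    refine ContinuousLinearMap.ext_on (s := range e) ?_ ?_
    · rw [dense_iff_closure_eq, ← Submodule.topologicalClosure_coe, e.dense_span,
        Submodule.top_coe]
    · rintro _ ⟨j, rfl⟩
      rcases eq_or_ne i j with rfl | hij
      · simp [hD i]
      · simp [hD j, inner_hilbertBasis_eq_zero e hij]
  · intro h i
    refine ext_inner_hilbertBasis e fun j => ?_
    rw [h, inner_smul_right]
    rcases eq_or_ne j i with rfl | hij
    · rfl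
    · rw [inner_hilbertBasis_eq_zero e hij, mul_zero, mul_zero]

theorem IsDiagonal.inner_apply (hD : IsDiagonal e D m) (x : E) (i : ι) :
    inner 𝕜 (e i) (D x) = m i * inner 𝕜 (e i) x :=
  isDiagonal_iff_inner.1 hD x i

theorem IsDiagonal.norm_le (hD : IsDiagonal e D m) {C : ℝ} (hC : 0 ≤ C) (hm : ∀ i, ‖m i‖ ≤ C) :
    ‖D‖ ≤ C :=
  D.opNorm_le_bound hC fun x => norm_le_of_norm_inner_le e hC fun i => by
    rw [hD.inner_apply, norm_mul]
    gcongr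
    exact hm i

theorem exists_isDiagonal {C : ℝ} (hm : ∀ i, ‖m i‖ ≤ C) :
    ∃ D : E →L[𝕜] E, IsDiagonal e D m := by
  have hle (x : E) (i : ι) :
      ‖m i * inner 𝕜 (e i) x‖ ≤ max C 0 * ‖inner 𝕜 (e i) x‖ := by
    rw [norm_mul]
    gcongr
    exact (hm i).trans (le_max_left _ _)
  have hex (x : E) : ∃ y : E, ∀ i, inner 𝕜 (e i) y = m i * inner 𝕜 (e i) x := by
    refine exists_forall_inner_eq e (.of_nonneg_of_le (fun i => by positivity) (fun i => ?_)
      ((hasSum_norm_inner_sq e x).summable.mul_left (max C 0 ^ 2)))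
    rw [← mul_pow]
    exact pow_le_pow_left₀ (norm_nonneg _) (hle x i) 2
  choose f hf using hex
  let F : E →ₗ[𝕜] E :=
    { toFun := f
      map_add' := fun x y => ext_inner_hilbertBasis e fun i => by
        simp only [hf, inner_add_right, mul_add]
      map_smul' := fun c x => ext_inner_hilbertBasis e fun i => by
        simp only [hf, inner_smul_right, RingHom.id_apply, mul_left_comm] }
  have hF (x : E) : ‖F x‖ ≤ max C 0 * ‖x‖ :=
    norm_le_of_norm_inner_le e (le_max_right _ _) fun i => (hf x i).symm ▸ hle x i
  exact ⟨F.mkContinuous _ hF, isDiagonal_iff_inner.2 hf⟩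

theorem IsDiagonal.pointSpectrum_eq_range (hD : IsDiagonal e D m) : pointSpectrum D = range m := by
  ext z
  constructor
  · intro hz
    obtain ⟨v, hv⟩ := Module.End.HasEigenvalue.exists_hasEigenvector hz
    by_contra! hne
    refine hv.2 (ext_inner_hilbertBasis e fun i => ?_)
    have h : inner 𝕜 (e i) (D v) = inner 𝕜 (e i) (z • v) := congrArg _ hv.apply_eq_smul
    rw [hD.inner_apply, inner_smul_right, mul_eq_mul_right_iff] at h
    rw [inner_zero_right, h.resolve_left fun h' => hne ⟨i, h'⟩]
  · rintro ⟨i, rfl⟩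
    exact Module.End.hasEigenvalue_of_hasEigenvector
      ⟨Module.End.mem_eigenspace_iff.2 (hD i), e.orthonormal.ne_zero i⟩

theorem IsDiagonal.ker_eq_bot_iff (hD : IsDiagonal e D m) :
    LinearMap.ker (D : E →ₗ[𝕜] E) = ⊥ ↔ ∀ i, m i ≠ 0 := by
  have h : (0 : 𝕜) ∈ pointSpectrum D ↔ (0 : 𝕜) ∈ range m := by rw [hD.pointSpectrum_eq_range]
  rw [pointSpectrum, mem_ofPred_eq, Module.End.hasEigenvalue_iff, Module.End.eigenspace_zero] at h
  simpa using h.not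

theorem IsDiagonal.add {D' : E →L[𝕜] E} {m' : ι → 𝕜} (hD : IsDiagonal e D m)
    (hD' : IsDiagonal e D' m') : IsDiagonal e (D + D') (m + m') := fun i => by
  rw [_root_.add_apply, hD, hD', Pi.add_apply, add_smul]

theorem IsDiagonal.const_smul (hD : IsDiagonal e D m) (c : 𝕜) : IsDiagonal e (c • D) (c • m) :=
  fun i => by rw [_root_.smul_apply, hD, Pi.smul_apply, smul_assoc]

end Diagonal

section Resolvent

variable {A : E →ₗ.[𝕜] E} {z w : 𝕜} {R : E →L[𝕜] E}

theorem IsResolventAt.mem_graph (hR : IsResolventAt A z R) (y : E) :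
    (R y, z • R y - y) ∈ A.graph := by
  obtain ⟨h, hy⟩ := hR.1 y
  rw [LinearPMap.mem_graph_iff]
  exact ⟨⟨R y, h⟩, rfl, (sub_eq_iff_eq_add.2 (sub_eq_iff_eq_add'.1 hy)).symm⟩

theorem IsResolventAt.apply_of_mem_graph (hR : IsResolventAt A z R) {x y : E}
    (h : (x, y) ∈ A.graph) : R (z • x - y) = x := by
  rw [LinearPMap.mem_graph_iff] at h
  obtain ⟨x', rfl, rfl⟩ := h
  exact hR.2 x'

theorem isResolventAt_of_graph (h_mem : ∀ y, (R y, z • R y - y) ∈ A.graph)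
    (h_apply : ∀ x y, (x, y) ∈ A.graph → R (z • x - y) = x) : IsResolventAt A z R := by
  refine ⟨fun y => ?_, fun x => h_apply _ _ (A.mem_graph x)⟩
  obtain ⟨⟨x, hx⟩, rfl, hAx⟩ := (LinearPMap.mem_graph_iff A).1 (h_mem y)
  exact ⟨hx, by rw [hAx, sub_sub_cancel]⟩

theorem IsResolventAt.mul_units_inv (hR : IsResolventAt A z R) {u : (E →L[𝕜] E)ˣ}
    (hu : (u : E →L[𝕜] E) = 1 - (z - w) • R) : IsResolventAt A w (R * ↑u⁻¹) := by
  set V : E →L[𝕜] E := ↑u⁻¹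
  have right_inv (y : E) : V y - (z - w) • R (V y) = y := by
    simpa [hu] using DFunLike.congr_fun u.mul_inv y
  have left_inv (y : E) : V (y - (z - w) • R y) = y := by
    simpa [hu] using DFunLike.congr_fun u.inv_mul y
  refine isResolventAt_of_graph (fun y => ?_) fun x y hxy => ?_
  · have h := hR.mem_graph (V y)
    rwa [show z • R (V y) - V y = w • R (V y) - (V y - (z - w) • R (V y)) by module,
      right_inv] at h
  · have h := left_inv (z • x - y)
    rw [hR.apply_of_mem_graph hxy, show z • x - y - (z - w) • x = w • x - y by module] at h
    exact (congrArg R h).trans (hR.apply_of_mem_graph hxy)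

theorem HasCompactResolvent.exists_isResolventAt [CompleteSpace E] (hA : HasCompactResolvent A)
    (hw : ∀ x : E, (x, w • x) ∈ A.graph → x = 0) :
    ∃ R : E →L[𝕜] E, IsResolventAt A w R ∧ IsCompactOperator R := by
  obtain ⟨z, R, hR, hcomp⟩ := hA
  have hcomp' : IsCompactOperator ((z - w) • R : E →L[𝕜] E) := hcomp.smul (z - w)
  rcases hcomp'.hasEigenvalue_or_mem_resolventSet one_ne_zero with heig | hres
  · obtain ⟨v, hv⟩ := heig.exists_hasEigenvector
    have hRv : R ((z - w) • v) = v := by simpa using hv.apply_eq_smul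
    have hgraph := hR.mem_graph ((z - w) • v)
    rw [hRv, show z • v - (z - w) • v = w • v by module] at hgraph
    exact absurd (hw v hgraph) hv.2
  · obtain ⟨u, hu⟩ := _root_.spectrum.mem_resolventSet_iff.1 hres
    rw [map_one] at hu
    exact ⟨_, hR.mul_units_inv hu, hcomp.comp_clm _⟩

theorem IsResolventAt.isSymmetric {c : ℝ} (hA : A.IsFormalAdjoint A)
    (hR : IsResolventAt A (c : 𝕜) R) : (R : E →ₗ[𝕜] E).IsSymmetric := by
  intro x y
  obtain ⟨u, hu, hAu⟩ := (LinearPMap.mem_graph_iff A).1 (hR.mem_graph x)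
  obtain ⟨v, hv, hAv⟩ := (LinearPMap.mem_graph_iff A).1 (hR.mem_graph y)
  have h := hA u v
  simp only at hu hAu hv hAv
  rw [hu, hAu, hv, hAv, inner_sub_left, inner_sub_right, inner_smul_left, inner_smul_right,
    RCLike.conj_ofReal] at h
  exact (sub_right_injective h).symm

theorem BoundedAboveBy.le_of_mem_graph {α : ℝ} (hα : BoundedAboveBy A α) {x : E} {μ : ℝ}
    (hx : x ≠ 0) (h : (x, (μ : 𝕜) • x) ∈ A.graph) : μ ≤ α := by
  obtain ⟨u, rfl, hAu⟩ := (LinearPMap.mem_graph_iff A).1 h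
  have := hα u
  rw [hAu, inner_smul_left, RCLike.conj_ofReal, RCLike.re_ofReal_mul,
    inner_self_eq_norm_sq] at this
  exact le_of_mul_le_mul_right this (by positivity)

end Resolvent

section SpectralTheorem

variable [CompleteSpace E]

theorem exists_hilbertBasis_of_orthogonalFamily {κ : Type*} {V : κ → Submodule 𝕜 E}
    [∀ k, CompleteSpace (V k)]
    (hV : OrthogonalFamily 𝕜 (fun k => V k) fun k => (V k).subtypeₗᵢ) (hbot : (⨆ k, V k)ᗮ = ⊥) :
    ∃ (s : Set E) (e : HilbertBasis s 𝕜 E), ∀ i, ∃ k, e i ∈ V k := by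
  choose w b _ using fun k => exists_hilbertBasis 𝕜 (V k)
  have hon : Orthonormal 𝕜 fun i : Σ k, w k => (b i.1 i.2 : E) :=
    hV.orthonormal_sigma_orthonormal (v_family := fun k => b k) fun k => (b k).orthonormal
  have hspan : (Submodule.span 𝕜 (range fun i : Σ k, w k => (b i.1 i.2 : E)))ᗮ = ⊥ := by
    rw [eq_bot_iff, ← hbot, ← Submodule.iInf_orthogonal]
    refine fun x hx => (Submodule.mem_iInf _).2 fun k => (Submodule.mem_orthogonal' _ _).2 ?_
    intro y hy
    have hsum := (((b k).hasSum_repr ⟨y, hy⟩).mapL (V k).subtypeL).mapL (innerSL 𝕜 x)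
    refine hsum.unique (hasSum_zero.congr_fun fun i => ?_)
    have : inner 𝕜 x (b k i : E) = 0 :=
      (Submodule.mem_orthogonal' _ _).1 hx _ (Submodule.subset_span ⟨⟨k, i⟩, rfl⟩)
    simp [this]
  have hspan' : (Submodule.span 𝕜
      (range ((↑) : range (fun i : Σ k, w k => (b i.1 i.2 : E)) → E)))ᗮ = ⊥ := by
    rwa [Subtype.range_coe]
  refine ⟨_, HilbertBasis.mkOfOrthogonalEqBot hon.toSubtypeRange hspan', ?_⟩
  rintro ⟨_, ⟨k, i⟩, rfl⟩
  rw [HilbertBasis.coe_mkOfOrthogonalEqBot]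
  exact ⟨k, (b k i).2⟩

theorem exists_isDiagonal_of_isCompactOperator {R : E →L[𝕜] E} (hcomp : IsCompactOperator R)
    (hsym : (R : E →ₗ[𝕜] E).IsSymmetric) :
    ∃ (s : Set E) (e : HilbertBasis s 𝕜 E) (μ : s → ℝ), IsDiagonal e R fun i => (μ i : 𝕜) := by
  have (μ : 𝕜) : CompleteSpace (Module.End.eigenspace (R : E →ₗ[𝕜] E) μ) := by
    have hset : (Module.End.eigenspace (R : E →ₗ[𝕜] E) μ : Set E) = {x | R x = μ • x} := by
      ext x
      simp
    refine IsClosed.completeSpace_coe (hs := ?_)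
    rw [hset]
    exact isClosed_eq R.continuous (continuous_const_smul μ)
  obtain ⟨s, e, he⟩ := exists_hilbertBasis_of_orthogonalFamily hsym.orthogonalFamily_eigenspaces
    (ContinuousLinearMap.orthogonalComplement_iSup_eigenspaces_eq_bot hcomp hsym)
  choose μ hμ using he
  refine ⟨s, e, fun i => RCLike.re (μ i), fun i => ?_⟩
  have heig : Module.End.HasEigenvalue (R : E →ₗ[𝕜] E) (μ i) :=
    Module.End.hasEigenvalue_of_hasEigenvector ⟨hμ i, e.orthonormal.ne_zero i⟩
  simp only [RCLike.conj_eq_iff_re.1 (hsym.conj_eigenvalue_eq_self heig)]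
  exact Module.End.mem_eigenspace_iff.1 (hμ i)

end SpectralTheorem

theorem norm_le_norm_sub_of_inner_eq_zero {x y : E} (h : inner 𝕜 x y = 0) : ‖x‖ ≤ ‖x - y‖ := by
  refine le_of_sq_le_sq ?_ (norm_nonneg _)
  rw [norm_sub_sq (𝕜 := 𝕜), h]
  simp

theorem IsDiagonal.tendsto_cofinite_zero {e : HilbertBasis ι 𝕜 E} {R : E →L[𝕜] E} {μ : ι → 𝕜}
    (hR : IsDiagonal e R μ) (hcomp : IsCompactOperator R) : Tendsto μ cofinite (𝓝 0) := by
  rw [Metric.tendsto_nhds]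
  intro ε hε
  by_contra hinf
  obtain ⟨K, hK, hKsub⟩ := hcomp.image_closedBall_subset_compact (𝕜₁ := 𝕜) 1
  let g : ℕ ↪ {i | ¬ dist (μ i) 0 < ε} := Set.Infinite.natEmbedding _ hinf
  obtain ⟨y, _, φ, hφ, hlim⟩ := hK.tendsto_subseq (x := fun n => R (e (g n)))
    fun n => hKsub ⟨_, by simp [e.orthonormal.norm_eq_one], rfl⟩
  obtain ⟨n, hn⟩ := Metric.cauchySeq_iff'.1 hlim.cauchySeq ε hε
  set i := (g (φ (n + 1)) : ι)
  set j := (g (φ n) : ι)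
  have hij : i ≠ j := fun h =>
    (Nat.lt_succ_self n).ne' (hφ.injective (g.injective (Subtype.ext h)))
  have horth : inner 𝕜 (μ i • e i) (μ j • e j) = 0 := by
    rw [inner_smul_left, inner_smul_right, inner_hilbertBasis_eq_zero e hij, mul_zero, mul_zero]
  have hlt : ‖μ i • e i - μ j • e j‖ < ε := by
    rw [← hR i, ← hR j, ← dist_eq_norm]
    exact hn (n + 1) (Nat.le_succ n)
  have hle : ε ≤ ‖μ i • e i‖ := by
    rw [norm_smul, e.orthonormal.norm_eq_one, mul_one, ← dist_zero_right]
    exact not_lt.1 (g (φ (n + 1))).2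
  exact absurd (hle.trans (norm_le_norm_sub_of_inner_eq_zero horth)) hlt.not_ge

/-- In the coordinates of the Hilbert basis `e`, the unbounded operator `A` is multiplication by
`m`, on the largest domain for which this makes sense. -/
def IsDiagonalizedBy (A : E →ₗ.[𝕜] E) (e : HilbertBasis ι 𝕜 E) (m : ι → 𝕜) : Prop :=
  ∀ x y : E, (x, y) ∈ A.graph ↔ ∀ i, inner 𝕜 (e i) y = m i * inner 𝕜 (e i) x

theorem IsResolventAt.isDiagonalizedBy {A : E →ₗ.[𝕜] E} {z : 𝕜} {R : E →L[𝕜] E}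
    {e : HilbertBasis ι 𝕜 E} {μ : ι → 𝕜} (hR : IsResolventAt A z R) (hD : IsDiagonal e R μ)
    (hμ : ∀ i, μ i ≠ 0) : IsDiagonalizedBy A e fun i => z - (μ i)⁻¹ := by
  intro x y
  constructor
  · intro h i
    have hx := hD.inner_apply (z • x - y) i
    rw [hR.apply_of_mem_graph h, inner_sub_right, inner_smul_right, ← inv_mul_eq_iff_eq_mul₀ (hμ i)]
      at hx
    linear_combination hx
  · intro h
    have hx : R (z • x - y) = x := ext_inner_hilbertBasis e fun i => by
      rw [hD.inner_apply, inner_sub_right, inner_smul_right, h]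
      field_simp [hμ i]
      ring
    simpa only [hx, sub_sub_cancel] using hR.mem_graph (z • x - y)

theorem IsResolventAt.isDiagonal_ne_zero {A : E →ₗ.[𝕜] E} {z : 𝕜} {R : E →L[𝕜] E}
    {e : HilbertBasis ι 𝕜 E} {μ : ι → 𝕜} (hR : IsResolventAt A z R) (hD : IsDiagonal e R μ)
    (i : ι) : μ i ≠ 0 := by
  intro h0
  have h := hR.mem_graph (e i)
  rw [hD, h0, zero_smul, smul_zero, zero_sub] at h
  exact e.orthonormal.ne_zero i (neg_eq_zero.1 (LinearPMap.graph_fst_eq_zero_snd A h rfl))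

section Diagonalized

variable {A : E →ₗ.[𝕜] E} {e : HilbertBasis ι 𝕜 E} {m : ι → 𝕜}

theorem IsDiagonalizedBy.basis_mem_graph (hA : IsDiagonalizedBy A e m) (i : ι) :
    (e i, m i • e i) ∈ A.graph := by
  refine (hA _ _).2 fun j => ?_
  rw [inner_smul_right]
  rcases eq_or_ne j i with rfl | hne
  · rfl
  · rw [inner_hilbertBasis_eq_zero e hne, mul_zero, mul_zero]

theorem IsDiagonalizedBy.le_of_boundedAboveBy {lam : ι → ℝ} {α : ℝ}
    (hA : IsDiagonalizedBy A e fun i => (lam i : 𝕜)) (hα : BoundedAboveBy A α) (i : ι) :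
    lam i ≤ α :=
  hα.le_of_mem_graph (e.orthonormal.ne_zero i) (hA.basis_mem_graph i)

theorem exists_isDiagonalizedBy [CompleteSpace E] (hA : A.IsFormalAdjoint A) {α : ℝ}
    (hα : BoundedAboveBy A α) (hcomp : HasCompactResolvent A) :
    ∃ (s : Set E) (e : HilbertBasis s 𝕜 E) (lam : s → ℝ),
      IsDiagonalizedBy A e (fun i => (lam i : 𝕜)) ∧ Tendsto lam cofinite atBot := by
  obtain ⟨R, hR, hRcomp⟩ := hcomp.exists_isResolventAt (w := ((α + 1 : ℝ) : 𝕜)) fun x hx => by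
    by_contra hne
    exact (lt_add_one α).not_ge (hα.le_of_mem_graph hne hx)
  obtain ⟨s, e, μ, hD⟩ := exists_isDiagonal_of_isCompactOperator hRcomp (hR.isSymmetric hA)
  have hdiag : IsDiagonalizedBy A e fun i => ((α + 1 - (μ i)⁻¹ : ℝ) : 𝕜) := by
    simpa using hR.isDiagonalizedBy hD (hR.isDiagonal_ne_zero hD)
  have hpos (i : s) : 0 < μ i := by
    have := hdiag.le_of_boundedAboveBy hα i
    exact inv_pos.1 (by linarith)
  have hlim : Tendsto μ cofinite (𝓝[>] 0) := by
    refine tendsto_nhdsWithin_iff.2 ⟨?_, .of_forall hpos⟩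
    simpa [Function.comp_def] using
      (RCLike.continuous_re.tendsto (0 : 𝕜)).comp (hD.tendsto_cofinite_zero hRcomp)
  exact ⟨s, e, _, hdiag,
    tendsto_atBot_add_const_left _ _ (tendsto_neg_atTop_atBot.comp hlim.inv_tendsto_nhdsGT_zero)⟩

theorem IsDiagonalizedBy.mem_eigenspace_iff (hA : IsDiagonalizedBy A e m) {μ : 𝕜} {x : E} :
    x ∈ eigenspace A μ ↔ ∀ i, m i ≠ μ → inner 𝕜 (e i) x = 0 := by
  refine (hA x (μ • x)).trans (forall_congr' fun i => ?_)
  rw [inner_smul_right, mul_eq_mul_right_iff, or_iff_not_imp_left, ne_comm, ne_eq]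

theorem IsDiagonalizedBy.span_le_eigenspace (hA : IsDiagonalizedBy A e m) (μ : 𝕜) :
    Submodule.span 𝕜 (e '' {i | m i = μ}) ≤ eigenspace A μ := by
  rw [Submodule.span_le]
  rintro _ ⟨i, rfl, rfl⟩
  exact hA.basis_mem_graph i

theorem IsDiagonalizedBy.eigenspace_eq_span (hA : IsDiagonalizedBy A e m) {μ : 𝕜}
    (hμ : {i | m i = μ}.Finite) : eigenspace A μ = Submodule.span 𝕜 (e '' {i | m i = μ}) := by
  refine le_antisymm (fun x hx => ?_) (hA.span_le_eigenspace μ)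
  have hsum : HasSum (fun i => e.repr x i • e i) (∑ i ∈ hμ.toFinset, e.repr x i • e i) :=
    hasSum_sum_of_ne_finset_zero fun i hi => by
      rw [e.repr_apply_apply, hA.mem_eigenspace_iff.1 hx i (hi <| hμ.mem_toFinset.2 ·), zero_smul]
  rw [(e.hasSum_repr x).unique hsum]
  exact Submodule.sum_mem _ fun i hi => Submodule.smul_mem _ _
    (Submodule.subset_span (mem_image_of_mem e (hμ.mem_toFinset.1 hi)))

theorem toENat_rank_span_image (e : HilbertBasis ι 𝕜 E) (F : Set ι) :
    Cardinal.toENat (Module.rank 𝕜 (Submodule.span 𝕜 (e '' F))) = F.encard := by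
  have hindep := e.orthonormal.linearIndependent
  rw [rank_span_set (hindep.linearIndepOn_id.mono (image_subset_range e F)), toENat_cardinalMk,
    hindep.injective.encard_image]

theorem IsDiagonalizedBy.toENat_rank_eigenspace (hA : IsDiagonalizedBy A e m) (μ : 𝕜) :
    Cardinal.toENat (Module.rank 𝕜 (eigenspace A μ)) = {i | m i = μ}.encard := by
  rcases {i | m i = μ}.finite_or_infinite with hfin | hinf
  · rw [hA.eigenspace_eq_span hfin, toENat_rank_span_image]
  · have h := OrderHomClass.mono Cardinal.toENat (Submodule.rank_mono (hA.span_le_eigenspace μ))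
    rw [toENat_rank_span_image, hinf.encard_eq] at h
    rw [top_le_iff.1 h, hinf.encard_eq]

theorem IsDiagonalizedBy.isResolventAt (hA : IsDiagonalizedBy A e m) {z : 𝕜} {R : E →L[𝕜] E}
    (hR : IsDiagonal e R fun i => (z - m i)⁻¹) (hz : ∀ i, z - m i ≠ 0) : IsResolventAt A z R := by
  refine isResolventAt_of_graph (fun y => (hA _ _).2 fun i => ?_) fun x y hxy => ?_
  · rw [inner_sub_right, inner_smul_right, hR.inner_apply]
    field_simp [hz i]
    ring
  · refine ext_inner_hilbertBasis e fun i => ?_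
    rw [hR.inner_apply, inner_sub_right, inner_smul_right, (hA x y).1 hxy, ← sub_mul,
      inv_mul_cancel_left₀ (hz i)]

theorem IsDiagonalizedBy.spectrum_eq_closure_range (hA : IsDiagonalizedBy A e m) :
    spectrum A = closure (range m) := by
  ext z
  rw [spectrum, mem_compl_iff, not_iff_comm, Metric.mem_closure_range_iff]
  push Not
  constructor
  · rintro ⟨ε, hε, hz⟩
    simp only [dist_eq_norm] at hz
    obtain ⟨R, hR⟩ := exists_isDiagonal (e := e) (m := fun i => (z - m i)⁻¹) (C := ε⁻¹)
      fun i => by rw [norm_inv]; exact inv_anti₀ hε (hz i)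
    exact ⟨R, hA.isResolventAt hR fun i => norm_pos_iff.1 (hε.trans_le (hz i))⟩
  · rintro ⟨R, hR⟩
    refine ⟨(‖R‖ + 1)⁻¹, by positivity, fun i => ?_⟩
    have hRe : R ((z - m i) • e i) = e i := by
      rw [sub_smul]
      exact hR.apply_of_mem_graph (hA.basis_mem_graph i)
    rw [dist_eq_norm, inv_le_iff_one_le_mul₀' (by positivity)]
    calc 1 = ‖R ((z - m i) • e i)‖ := by rw [hRe, e.orthonormal.norm_eq_one]
      _ ≤ ‖R‖ * ‖z - m i‖ := by
        simpa [norm_smul, e.orthonormal.norm_eq_one] using R.le_opNorm ((z - m i) • e i)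
      _ ≤ (‖R‖ + 1) * ‖z - m i‖ := by gcongr; linarith

end Diagonalized

theorem isClosed_range_of_tendsto_cofinite_cocompact {X : Type*} [TopologicalSpace X] [T2Space X]
    [WeaklyLocallyCompactSpace X] {f : ι → X} (hf : Tendsto f cofinite (cocompact X)) :
    IsClosed (range f) := by
  let _ : TopologicalSpace ι := ⊥
  have : DiscreteTopology ι := ⟨rfl⟩
  rw [← cocompact_eq_cofinite ι] at hf
  exact (isProperMap_iff_tendsto_cocompact.2 ⟨continuous_of_discreteTopology, hf⟩).isClosed_range

theorem tendsto_ofReal_cocompact {lam : ι → ℝ} (hlam : Tendsto lam cofinite atBot) :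
    Tendsto (fun i => (lam i : 𝕜)) cofinite (cocompact 𝕜) := by
  rw [← Metric.cobounded_eq_cocompact]
  exact (RCLike.tendsto_ofReal_cobounded_cobounded 𝕜).comp
    (hlam.mono_right IsOrderBornology.atBot_le_cobounded)

theorem IsDiagonalizedBy.spectrum_eq_range {A : E →ₗ.[𝕜] E} {e : HilbertBasis ι 𝕜 E} {lam : ι → ℝ}
    (hA : IsDiagonalizedBy A e fun i => (lam i : 𝕜)) (hlam : Tendsto lam cofinite atBot) :
    spectrum A = range fun i => (lam i : 𝕜) := by
  rw [hA.spectrum_eq_closure_range]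
  exact (isClosed_range_of_tendsto_cofinite_cocompact (tendsto_ofReal_cocompact hlam)).closure_eq

section ExpEstimates

theorem exp_mul_le_exp_mul_abs {t r l a : ℝ} (ht : 0 ≤ t) (htr : t ≤ r) (hl : l ≤ a) :
    Real.exp (t * l) ≤ Real.exp (r * |a|) :=
  Real.exp_le_exp.2 <| (mul_le_mul_of_nonneg_left (hl.trans (le_abs_self a)) ht).trans
    (mul_le_mul_of_nonneg_right htr (abs_nonneg a))

theorem abs_exp_sub_one_le {u v : ℝ} (huv : u ≤ v) (hv : 0 ≤ v) :
    |Real.exp u - 1| ≤ Real.exp v * |u| := by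
  have h := (convex_Iic v).norm_image_sub_le_of_norm_deriv_le (f := Real.exp)
    (fun x _ => Real.differentiableAt_exp) (C := Real.exp v) (fun x hx => ?_) hv huv
  · simpa using h
  · rw [Real.deriv_exp, Real.norm_eq_abs, Real.abs_exp]
    exact Real.exp_le_exp.2 hx

theorem abs_inv_mul_exp_sub_one_le {h l a : ℝ} (hh : 0 < h) (hh1 : h ≤ 1) (hl : l ≤ a) :
    |h⁻¹ * (Real.exp (h * l) - 1)| ≤ Real.exp |a| * |l| := by
  have hle : h * l ≤ |a| := by
    simpa using exp_mul_le_exp_mul_abs hh.le hh1 hl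
  rw [abs_mul, abs_of_pos (inv_pos.2 hh), inv_mul_le_iff₀ hh]
  calc |Real.exp (h * l) - 1| ≤ Real.exp |a| * |h * l| := abs_exp_sub_one_le hle (abs_nonneg a)
    _ = h * (Real.exp |a| * |l|) := by rw [abs_mul, abs_of_pos hh]; ring

theorem tendsto_inv_mul_exp_sub_one (l : ℝ) :
    Tendsto (fun h : ℝ => h⁻¹ * (Real.exp (h * l) - 1)) (𝓝[>] 0) (𝓝 l) := by
  have hd : HasDerivAt (fun h : ℝ => Real.exp (h * l)) l 0 := by
    simpa using ((hasDerivAt_id (0 : ℝ)).mul_const l).exp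
  have := (hasDerivAt_iff_tendsto_slope_zero.1 hd).mono_left
    (nhdsWithin_mono 0 fun x (hx : x ∈ Ioi (0 : ℝ)) => (mem_Ioi.1 hx).ne')
  simpa using this

theorem abs_mul_exp_mul_le {r δ ρ l a : ℝ} (hδ : 0 < δ) (hδr : δ ≤ r) (hrρ : r ≤ ρ)
    (hl : l ≤ a) : |l| * Real.exp (r * l) ≤ δ⁻¹ * Real.exp (ρ * |2 * a|) := by
  have hr : 0 < r := hδ.trans_le hδr
  have habs : |l| + l ≤ |2 * a| := by
    rw [abs_mul, abs_two]
    rcases abs_cases l with h | h <;> linarith [le_abs_self a, abs_nonneg a]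
  calc |l| * Real.exp (r * l)
      = r⁻¹ * (r * |l| * Real.exp (r * l)) := by field_simp
    _ ≤ r⁻¹ * (Real.exp (r * |l|) * Real.exp (r * l)) := by
        gcongr
        linarith [Real.add_one_le_exp (r * |l|)]
    _ = r⁻¹ * Real.exp (r * (|l| + l)) := by rw [← Real.exp_add, mul_add]
    _ ≤ δ⁻¹ * Real.exp (ρ * |2 * a|) := by
        gcongr
        · linarith [neg_abs_le l]
        · exact hr.le.trans hrρ

theorem abs_exp_mul_sub_exp_mul_le {s t δ ρ l a : ℝ} (hδ : 0 < δ) (hs : s ∈ Icc δ ρ)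
    (ht : t ∈ Icc δ ρ) (hl : l ≤ a) :
    |Real.exp (s * l) - Real.exp (t * l)| ≤ δ⁻¹ * Real.exp (ρ * |2 * a|) * |s - t| := by
  refine (convex_Icc δ ρ).norm_image_sub_le_of_norm_hasDerivWithin_le
    (f := fun r => Real.exp (r * l)) (f' := fun r => Real.exp (r * l) * l)
    (fun r _ => ?_) (fun r hr => ?_) ht hs
  · simpa using (((hasDerivAt_id r).mul_const l).exp).hasDerivWithinAt
  · rw [norm_mul, Real.norm_eq_abs, Real.norm_eq_abs, Real.abs_exp, mul_comm]
    exact abs_mul_exp_mul_le hδ hr.1 hr.2 hl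

theorem eq_exp_smul_of_hasDerivWithinAt_right {F : Type*} [NormedAddCommGroup F] [NormedSpace ℝ F]
    {f : ℝ → F} {l t : ℝ} (ht : 0 ≤ t) (hcont : ContinuousOn f (Icc 0 t))
    (hderiv : ∀ s ∈ Ico 0 t, HasDerivWithinAt f (l • f s) (Ici s) s) :
    f t = Real.exp (t * l) • f 0 := by
  have hexp (s : ℝ) :
      HasDerivAt (fun s : ℝ => Real.exp (-(s * l))) (Real.exp (-(s * l)) * -l) s := by
    simpa using ((hasDerivAt_id s).mul_const l).neg.exp
  have hconst : Real.exp (-(t * l)) • f t = Real.exp (-(0 * l)) • f 0 := by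
    refine constant_of_has_deriv_right_zero (f := fun s => Real.exp (-(s * l)) • f s)
      (.smul (by fun_prop) hcont) (fun s hs => ?_) t ⟨ht, le_rfl⟩
    exact ((hexp s).hasDerivWithinAt.smul (hderiv s hs)).congr_deriv (by module)
  rw [zero_mul, neg_zero, Real.exp_zero, one_smul] at hconst
  rw [← hconst, smul_smul, ← Real.exp_add, add_neg_cancel, Real.exp_zero, one_smul]

end ExpEstimates

/-- For `t ≥ 0`, the operator `S t` is diagonal in the Hilbert basis `e` with diagonal entries
`e^{t λ_i}`; nothing is required of `S t` for `t < 0`. -/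
def IsDiagonalSemigroup (S : ℝ → E →L[𝕜] E) (e : HilbertBasis ι 𝕜 E) (lam : ι → ℝ) : Prop :=
  ∀ t : ℝ, 0 ≤ t → IsDiagonal e (S t) fun i => ((Real.exp (t * lam i) : ℝ) : 𝕜)

theorem exists_isDiagonalSemigroup (e : HilbertBasis ι 𝕜 E) {lam : ι → ℝ} {α : ℝ}
    (hlam : ∀ i, lam i ≤ α) : ∃ S : ℝ → E →L[𝕜] E, IsDiagonalSemigroup S e lam := by
  have hex (t : ℝ) : ∃ D : E →L[𝕜] E,
      IsDiagonal e D fun i => ((Real.exp (max t 0 * lam i) : ℝ) : 𝕜) :=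
    exists_isDiagonal fun i => by
      rw [RCLike.norm_ofReal, Real.abs_exp]
      exact exp_mul_le_exp_mul_abs (le_max_right t 0) le_rfl (hlam i)
  choose S hS using hex
  exact ⟨S, fun t ht => by simpa only [max_eq_left ht] using hS t⟩

section Semigroup

variable {A : E →ₗ.[𝕜] E} {S : ℝ → E →L[𝕜] E} {e : HilbertBasis ι 𝕜 E} {lam : ι → ℝ} {α : ℝ}

theorem IsDiagonalSemigroup.norm_inner_apply_le (hS : IsDiagonalSemigroup S e lam)
    (hlam : ∀ i, lam i ≤ α) {t r : ℝ} (ht : 0 ≤ t) (htr : t ≤ r) (x : E) (i : ι) :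
    ‖inner 𝕜 (e i) (S t x)‖ ≤ Real.exp (r * |α|) * ‖inner 𝕜 (e i) x‖ := by
  rw [(hS t ht).inner_apply, norm_mul, RCLike.norm_ofReal, Real.abs_exp]
  gcongr ?_ * _
  exact exp_mul_le_exp_mul_abs ht htr (hlam i)

theorem IsDiagonalSemigroup.isC0Semigroup (hS : IsDiagonalSemigroup S e lam)
    (hlam : ∀ i, lam i ≤ α) : IsC0Semigroup S where
  zero := by
    ext x
    exact ext_inner_hilbertBasis e fun i => by simp [(hS 0 le_rfl).inner_apply]
  add s t hs ht := by
    ext x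
    refine ext_inner_hilbertBasis e fun i => ?_
    rw [mul_apply_eq_comp, (hS _ (add_nonneg hs ht)).inner_apply, (hS s hs).inner_apply,
      (hS t ht).inner_apply, add_mul, Real.exp_add, RCLike.ofReal_mul, mul_assoc]
  continuousOn x := by
    intro t ht
    refine tendsto_of_tendsto_inner_of_dominated e (z := x) (C := Real.exp ((t + 1) * |α|))
      (fun i => ?_) ?_
    · have hcont : ContinuousOn (fun s => ((Real.exp (s * lam i) : ℝ) : 𝕜) * inner 𝕜 (e i) x)
          (Ici 0) := by fun_prop
      exact (hcont.congr fun s hs => (hS s hs).inner_apply x i) t ht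
    · filter_upwards [self_mem_nhdsWithin,
        mem_nhdsWithin_of_mem_nhds (Iic_mem_nhds (lt_add_one t))] with s hs0 hst
      exact hS.norm_inner_apply_le hlam hs0 hst x

theorem IsDiagonalSemigroup.inner_difference_quotient (hS : IsDiagonalSemigroup S e lam) {h : ℝ}
    (hh : 0 ≤ h) (x : E) (i : ι) : inner 𝕜 (e i) (((h⁻¹ : ℝ) : 𝕜) • (S h x - x)) =
      ((h⁻¹ * (Real.exp (h * lam i) - 1) : ℝ) : 𝕜) * inner 𝕜 (e i) x := by
  rw [inner_smul_right, inner_sub_right, (hS h hh).inner_apply, RCLike.ofReal_mul,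
    RCLike.ofReal_sub, RCLike.ofReal_one]
  ring

theorem IsDiagonalSemigroup.isGenerator (hS : IsDiagonalSemigroup S e lam)
    (hA : IsDiagonalizedBy A e fun i => (lam i : 𝕜)) (hlam : ∀ i, lam i ≤ α) :
    IsGenerator A S := by
  intro x y
  have hlim (i : ι) : Tendsto (fun h : ℝ => inner 𝕜 (e i) (((h⁻¹ : ℝ) : 𝕜) • (S h x - x)))
      (𝓝[>] 0) (𝓝 ((lam i : 𝕜) * inner 𝕜 (e i) x)) := by
    refine (((RCLike.continuous_ofReal (K := 𝕜)).tendsto _).comp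
      (tendsto_inv_mul_exp_sub_one (lam i))).mul_const _ |>.congr' ?_
    filter_upwards [self_mem_nhdsWithin] with h hh
    exact (hS.inner_difference_quotient (mem_Ioi.1 hh).le x i).symm
  rw [hA x y]
  constructor
  · intro hxy
    refine tendsto_of_tendsto_inner_of_dominated e (z := y) (C := Real.exp |α|)
      (fun i => by rw [hxy]; exact hlim i) ?_
    filter_upwards [Ioc_mem_nhdsGT (zero_lt_one' ℝ)] with h hh i
    rw [hS.inner_difference_quotient hh.1.le, hxy, norm_mul, norm_mul, ← mul_assoc,
      RCLike.norm_ofReal, RCLike.norm_ofReal]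
    gcongr ?_ * _
    exact abs_inv_mul_exp_sub_one_le hh.1 hh.2 (hlam i)
  · intro h i
    exact tendsto_nhds_unique (((innerSL 𝕜 (e i)).continuous.tendsto y).comp h) (hlim i)

theorem IsC0Semigroup.hasDerivWithinAt_inner (hS : IsC0Semigroup S) (hgen : IsGenerator A S)
    {x y : E} (hxy : (x, y) ∈ A.graph) {s : ℝ} (hs : 0 ≤ s) (w : E) :
    HasDerivWithinAt (fun u => inner 𝕜 w (S u x)) (inner 𝕜 w (S s y)) (Ici s) s := by
  rw [← hasDerivWithinAt_Ioi_iff_Ici, hasDerivWithinAt_iff_tendsto_slope' self_notMem_Ioi]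
  have hshift : Tendsto (fun u : ℝ => u - s) (𝓝[>] s) (𝓝[>] 0) := by
    refine tendsto_nhdsWithin_iff.2 ⟨?_, ?_⟩
    · simpa using ((continuous_sub_right s).tendsto s).mono_left nhdsWithin_le_nhds
    · filter_upwards [self_mem_nhdsWithin] with u hu using mem_Ioi.2 (sub_pos.2 (mem_Ioi.1 hu))
  have hquot := (((innerSL 𝕜 w).comp (S s)).continuous.tendsto y).comp
    (((hgen x y).1 hxy).comp hshift)
  refine hquot.congr' ?_
  filter_upwards [self_mem_nhdsWithin] with u hu
  have hsu : S u x = S s (S (u - s) x) := by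
    rw [← mul_apply_eq_comp, ← hS.add s (u - s) hs (sub_pos.2 (mem_Ioi.1 hu)).le, add_sub_cancel]
  simp only [Function.comp_apply, ContinuousLinearMap.comp_apply, map_smul, map_sub,
    innerSL_apply_apply, slope_def_module, smul_eq_mul, hsu, RCLike.real_smul_eq_coe_mul]

theorem IsC0Semigroup.apply_of_mem_graph (hS : IsC0Semigroup S) (hgen : IsGenerator A S) {x : E}
    {l : ℝ} (hx : (x, (l : 𝕜) • x) ∈ A.graph) {t : ℝ} (ht : 0 ≤ t) :
    S t x = ((Real.exp (t * l) : ℝ) : 𝕜) • x := by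
  refine ext_inner_left 𝕜 fun w => ?_
  have hcont : ContinuousOn (fun u => inner 𝕜 w (S u x)) (Icc 0 t) :=
    (innerSL 𝕜 w).continuous.comp_continuousOn ((hS.continuousOn x).mono Icc_subset_Ici_self)
  have h := eq_exp_smul_of_hasDerivWithinAt_right (l := l) ht hcont fun s hs => by
    simpa only [map_smul, inner_smul_right, RCLike.real_smul_eq_coe_mul] using
      hS.hasDerivWithinAt_inner hgen hx hs.1 w
  rw [h, hS.zero, one_apply_eq_self, inner_smul_right, RCLike.real_smul_eq_coe_mul]

theorem IsC0Semigroup.isDiagonalSemigroup (hS : IsC0Semigroup S) (hgen : IsGenerator A S)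
    (hA : IsDiagonalizedBy A e fun i => (lam i : 𝕜)) : IsDiagonalSemigroup S e lam :=
  fun _ ht i => hS.apply_of_mem_graph hgen (hA.basis_mem_graph i) ht

theorem opExp_spec (h : ∃ S : ℝ → E →L[𝕜] E, IsC0Semigroup S ∧ IsGenerator A S) :
    IsC0Semigroup (opExp A) ∧ IsGenerator A (opExp A) := by
  rw [opExp, dif_pos h]
  exact h.choose_spec

theorem IsDiagonalizedBy.isC0Semigroup_and_isGenerator_opExp
    (hA : IsDiagonalizedBy A e fun i => (lam i : 𝕜)) (hlam : ∀ i, lam i ≤ α) :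
    IsC0Semigroup (opExp A) ∧ IsGenerator A (opExp A) := by
  obtain ⟨S, hS⟩ := exists_isDiagonalSemigroup e hlam
  exact opExp_spec ⟨S, hS.isC0Semigroup hlam, hS.isGenerator hA hlam⟩

theorem IsDiagonalizedBy.isDiagonalSemigroup_opExp
    (hA : IsDiagonalizedBy A e fun i => (lam i : 𝕜)) (hlam : ∀ i, lam i ≤ α) :
    IsDiagonalSemigroup (opExp A) e lam :=
  have ⟨hS, hgen⟩ := hA.isC0Semigroup_and_isGenerator_opExp hlam
  hS.isDiagonalSemigroup hgen hA

theorem IsDiagonalSemigroup.norm_le (hS : IsDiagonalSemigroup S e lam) (hlam : ∀ i, lam i ≤ α)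
    {t r : ℝ} (ht : 0 ≤ t) (htr : t ≤ r) : ‖S t‖ ≤ Real.exp (r * |α|) :=
  (hS t ht).norm_le (Real.exp_pos _).le fun i => by
    rw [RCLike.norm_ofReal, Real.abs_exp]
    exact exp_mul_le_exp_mul_abs ht htr (hlam i)

theorem IsDiagonalSemigroup.norm_sub_le (hS : IsDiagonalSemigroup S e lam) (hlam : ∀ i, lam i ≤ α)
    {s t δ ρ : ℝ} (hδ : 0 < δ) (hs : s ∈ Icc δ ρ) (ht : t ∈ Icc δ ρ) :
    ‖S s - S t‖ ≤ δ⁻¹ * Real.exp (ρ * |2 * α|) * |s - t| := by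
  have hdiag : IsDiagonal e (S s - S t)
      fun i => ((Real.exp (s * lam i) - Real.exp (t * lam i) : ℝ) : 𝕜) := fun i => by
    simp only [_root_.sub_apply, hS s (hδ.le.trans hs.1) i, hS t (hδ.le.trans ht.1) i,
      RCLike.ofReal_sub, sub_smul]
  refine hdiag.norm_le (by positivity) fun i => ?_
  rw [RCLike.norm_ofReal]
  exact abs_exp_mul_sub_exp_mul_le hδ hs ht (hlam i)

-- The endpoint `0` is left out: norm continuity there would force the generator to be bounded.
theorem IsDiagonalSemigroup.continuousOn_Ioi (hS : IsDiagonalSemigroup S e lam)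
    (hlam : ∀ i, lam i ≤ α) : ContinuousOn S (Ioi 0) := by
  intro t (ht : 0 < t)
  have hlip : LipschitzOnWith (Real.toNNReal ((t / 2)⁻¹ * Real.exp (2 * t * |2 * α|))) S
      (Icc (t / 2) (2 * t)) :=
    .of_dist_le_mul fun s hs r hr => by
      rw [Real.coe_toNNReal _ (by positivity), dist_eq_norm, Real.dist_eq]
      exact hS.norm_sub_le hlam (half_pos ht) hs hr
  exact (hlip.continuousOn.continuousAt
    (Icc_mem_nhds (by linarith) (by linarith))).continuousWithinAt

theorem IsDiagonalSemigroup.intervalIntegrable (hS : IsDiagonalSemigroup S e lam)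
    (hlam : ∀ i, lam i ≤ α) {T : ℝ} (hT : 0 ≤ T) {b : ℝ → ℝ}
    (hb : IntervalIntegrable b volume 0 T) :
    IntervalIntegrable (fun t => ((b t : ℝ) : 𝕜) • S t) volume 0 T := by
  rw [intervalIntegrable_iff_integrableOn_Ioc_of_le hT] at hb ⊢
  refine (hb.ofReal (𝕜 := 𝕜)).smul_bdd (Real.exp (T * |α|))
    (((hS.continuousOn_Ioi hlam).mono Ioc_subset_Ioi_self).aestronglyMeasurable measurableSet_Ioc)
    ?_
  filter_upwards [ae_restrict_mem measurableSet_Ioc] with t ht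
    using hS.norm_le hlam ht.1.le ht.2

theorem IsDiagonal.intervalIntegral [CompleteSpace E] {D : ℝ → E →L[𝕜] E} {m : ℝ → ι → 𝕜} {a b : ℝ}
    (hD : ∀ t ∈ uIcc a b, IsDiagonal e (D t) (m t)) (hint : IntervalIntegrable D volume a b) :
    letI : NormedSpace ℝ (E →L[𝕜] E) := NormedSpace.restrictScalars ℝ 𝕜 (E →L[𝕜] E)
    IsDiagonal e (∫ t in a..b, D t) fun i => ∫ t in a..b, m t i := by
  let _ : NormedSpace ℝ (E →L[𝕜] E) := NormedSpace.restrictScalars ℝ 𝕜 (E →L[𝕜] E)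
  refine isDiagonal_iff_inner.2 fun x i => ?_
  rw [← intervalIntegral.integral_mul_const]
  refine (((innerSL 𝕜 (e i)).comp
    (ContinuousLinearMap.apply 𝕜 E x)).intervalIntegral_comp_comm hint).symm.trans ?_
  exact intervalIntegral.integral_congr fun t ht => (hD t ht).inner_apply x i

theorem IsDiagonalizedBy.isDiagonal_averagedSemigroup [CompleteSpace E]
    (hA : IsDiagonalizedBy A e fun i => (lam i : 𝕜)) (hlam : ∀ i, lam i ≤ α) {T : ℝ} (hT : 0 ≤ T)
    {b : ℝ → ℝ} (hb : IntervalIntegrable b volume 0 T) :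
    IsDiagonal e (averagedSemigroup A T b)
      fun i => ((∫ t in (0 : ℝ)..T, b t * Real.exp (lam i * t) : ℝ) : 𝕜) := by
  have hS := hA.isDiagonalSemigroup_opExp hlam
  have h := IsDiagonal.intervalIntegral
    (fun t ht => (hS t (uIcc_of_le hT ▸ ht).1).const_smul (b t : 𝕜))
    (hS.intervalIntegrable hlam hT hb)
  refine fun i => (h i).trans ?_
  simp only [Pi.smul_apply, smul_eq_mul, mul_comm _ (lam i), ← RCLike.ofReal_mul,
    RCLike.intervalIntegral_ofReal]

theorem IsDiagonalizedBy.isDiagonal_Phi [CompleteSpace E]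
    (hA : IsDiagonalizedBy A e fun i => (lam i : 𝕜)) (hlam : ∀ i, lam i ≤ α) {T : ℝ} (hT : 0 ≤ T)
    (a : ℝ) {b : ℝ → ℝ} (hb : IntervalIntegrable b volume 0 T) :
    IsDiagonal e (Phi A T a b) fun i =>
      ((a * Real.exp (T * lam i) + ∫ t in (0 : ℝ)..T, b t * Real.exp (lam i * t) : ℝ) : 𝕜) := by
  refine fun i => ((((hA.isDiagonalSemigroup_opExp hlam) T hT).const_smul (a : 𝕜)).add
    (hA.isDiagonal_averagedSemigroup hlam hT hb) i).trans ?_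
  simp

end Semigroup

theorem exists_orderIso_of_set_nat (s : Set ℕ) :
    ∃ N : ℕ∞, Nonempty ({j : ℕ // (j : ℕ∞) < N} ≃o s) := by
  rcases s.finite_or_infinite with hs | hs
  · lift s to Finset ℕ using hs
    let iso : {j : ℕ // (j : ℕ∞) < (s.card : ℕ∞)} ≃o Fin s.card :=
      { toFun := fun j => ⟨j, Nat.cast_lt.1 j.2⟩
        invFun := fun j => ⟨j, Nat.cast_lt.2 j.2⟩
        left_inv := fun _ => rfl
        right_inv := fun _ => rfl
        map_rel_iff' := Iff.rfl }
    exact ⟨s.card, ⟨iso.trans (s.orderIsoOfFin rfl)⟩⟩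
  · have := hs.to_subtype
    let iso : {j : ℕ // (j : ℕ∞) < ⊤} ≃o ℕ :=
      { Equiv.subtypeUnivEquiv ENat.natCast_lt_top with map_rel_iff' := Iff.rfl }
    exact ⟨⊤, ⟨iso.trans (Nat.Subtype.orderIsoOfNat s)⟩⟩

theorem exists_equiv_monotone_comp {β : Type*} [LinearOrder β] {k : ι → β}
    (hk : Function.Injective k) (hfin : ∀ i, {j | k j < k i}.Finite) :
    ∃ (N : ℕ∞) (σ : {j : ℕ // (j : ℕ∞) < N} ≃ ι), Monotone (k ∘ σ) := by
  let _ : LinearOrder ι := LinearOrder.lift' k hk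
  have hmono : StrictMono fun i : ι => (Iio i).ncard := fun i j hij =>
    ncard_lt_ncard (Iio_ssubset_Iio hij) (hfin j)
  obtain ⟨N, ⟨σ⟩⟩ := exists_orderIso_of_set_nat (range fun i : ι => (Iio i).ncard)
  exact ⟨N, (σ.trans (hmono.orderIso _).symm).toEquiv,
    fun i j hij => (σ.trans (hmono.orderIso _).symm).monotone hij⟩

theorem exists_equiv_antitone_comp {lam : ι → ℝ} (hlam : Tendsto lam cofinite atBot) :
    ∃ (N : ℕ∞) (σ : {j : ℕ // (j : ℕ∞) < N} ≃ ι), Antitone (lam ∘ σ) := by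
  have hfin (i : ι) : {j | lam i ≤ lam j}.Finite := by
    simpa only [not_lt] using eventually_cofinite.1 (hlam.eventually (eventually_lt_atBot (lam i)))
  -- Equal values of `lam` are listed in the order given by an arbitrary linear order on `ι`.
  obtain ⟨_, _⟩ := exists_wellFoundedLT ι
  let k : ι → ℝᵒᵈ ×ₗ ι := fun i => toLex (OrderDual.toDual (lam i), i)
  have hk : Function.Injective k := fun i j h => congrArg (fun p => (ofLex p).2) h
  obtain ⟨N, σ, hσ⟩ := exists_equiv_monotone_comp hk fun i =>
    (hfin i).subset fun j (hj : k j < k i) => Prod.Lex.monotone_fst _ _ hj.le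
  exact ⟨N, σ, fun i j hij => Prod.Lex.monotone_fst _ _ (hσ hij)⟩

section Spectral

variable {A : E →ₗ.[𝕜] E} {e : HilbertBasis ι 𝕜 E} {lam : ι → ℝ} {α : ℝ}

theorem IsDiagonalizedBy.exists_isEigenvalueEnumeration
    (hA : IsDiagonalizedBy A e fun i => (lam i : 𝕜)) (hlam : Tendsto lam cofinite atBot) :
    ∃ (N : ℕ∞) (l : {j : ℕ // (j : ℕ∞) < N} → ℝ), IsEigenvalueEnumeration A N l := by
  obtain ⟨N, σ, hσ⟩ := exists_equiv_antitone_comp hlam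
  refine ⟨N, lam ∘ σ, hσ, hlam.comp σ.injective.tendsto_cofinite, fun μ => ?_⟩
  rw [hA.toENat_rank_eigenspace,
    ← encard_preimage_of_bijective σ.bijective {i | (lam i : 𝕜) = μ}]
  rfl

theorem IsDiagonalizedBy.range_eq_of_isEigenvalueEnumeration
    (hA : IsDiagonalizedBy A e fun i => (lam i : 𝕜)) {N : ℕ∞} {l : {j : ℕ // (j : ℕ∞) < N} → ℝ}
    (hl : IsEigenvalueEnumeration A N l) : range l = range lam := by
  ext r
  have hcard : {j | l j = r}.encard = {i | lam i = r}.encard := by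
    simpa only [hA.toENat_rank_eigenspace, RCLike.ofReal_inj] using hl.multiplicity (r : 𝕜)
  have hnonempty : {j | l j = r}.Nonempty ↔ {i | lam i = r}.Nonempty := by
    rw [← encard_ne_zero, hcard, encard_ne_zero]
  exact hnonempty

theorem integral_mul_exp_eq (b : ℝ → ℝ) (l T : ℝ) :
    ∫ t in (0 : ℝ)..T, b t * Real.exp (l * t) =
      Real.exp (T * l) * ∫ t in (0 : ℝ)..T, b t * Real.exp (-l * (T - t)) := by
  rw [← intervalIntegral.integral_const_mul]
  refine intervalIntegral.integral_congr fun t _ => ?_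
  rw [mul_left_comm, ← Real.exp_add]
  ring_nf

theorem IsDiagonalizedBy.ker_Phi_eq_bot_iff [CompleteSpace E]
    (hA : IsDiagonalizedBy A e fun i => (lam i : 𝕜)) (hlam : ∀ i, lam i ≤ α) {T : ℝ} (hT : 0 ≤ T)
    (a : ℝ) {b : ℝ → ℝ} (hb : IntervalIntegrable b volume 0 T) :
    LinearMap.ker (Phi A T a b : E →ₗ[𝕜] E) = ⊥ ↔
      ∀ i, -a ≠ ∫ t in (0 : ℝ)..T, b t * Real.exp (-lam i * (T - t)) := by
  refine (hA.isDiagonal_Phi hlam hT a hb).ker_eq_bot_iff.trans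
    (forall_congr' fun i => not_congr ?_)
  rw [RCLike.ofReal_eq_zero, integral_mul_exp_eq, mul_comm a, ← mul_add, mul_eq_zero,
    or_iff_right (Real.exp_ne_zero _), neg_eq_iff_add_eq_zero]

theorem exp_neg_mul_integral_le {T l : ℝ} (hT : 0 ≤ T) (hl : l ≤ α) {b : ℝ → ℝ}
    (hb : IntervalIntegrable b volume 0 T) (hb0 : ∀ t ∈ Icc 0 T, 0 ≤ b t) :
    Real.exp (-(max α 0 * T)) * ∫ t in (0 : ℝ)..T, b t ≤
      ∫ t in (0 : ℝ)..T, b t * Real.exp (-l * (T - t)) := by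
  rw [mul_comm, ← intervalIntegral.integral_mul_const]
  refine intervalIntegral.integral_mono_on hT (hb.mul_const _)
    (hb.mul_continuousOn (by fun_prop)) fun t ht => ?_
  have hexponent : l * (T - t) ≤ max α 0 * T :=
    mul_le_mul (hl.trans (le_max_left _ _)) (sub_le_self T ht.1) (sub_nonneg.2 ht.2)
      (le_max_right _ _)
  rw [neg_mul]
  gcongr
  exact hb0 t ht

theorem IsDiagonalizedBy.ker_Phi_eq_bot_of_nonneg [CompleteSpace E]
    (hA : IsDiagonalizedBy A e fun i => (lam i : 𝕜)) (hlam : ∀ i, lam i ≤ α) {T : ℝ} (hT : 0 ≤ T)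
    {a : ℝ} {b : ℝ → ℝ} (hb : IntervalIntegrable b volume 0 T) (hb0 : ∀ t ∈ Icc 0 T, 0 ≤ b t)
    (h : (0 ≤ a ∧ 0 < ∫ t in (0 : ℝ)..T, b t) ∨ (α ≤ 0 ∧ -a < ∫ t in (0 : ℝ)..T, b t)) :
    LinearMap.ker (Phi A T a b : E →ₗ[𝕜] E) = ⊥ := by
  refine (hA.ker_Phi_eq_bot_iff hlam hT a hb).2 fun i =>
    (lt_of_lt_of_le ?_ (exp_neg_mul_integral_le hT (hlam i) hb hb0)).ne
  rcases h with ⟨ha, hint⟩ | ⟨hα, hint⟩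
  · exact (neg_nonpos.2 ha).trans_lt (mul_pos (Real.exp_pos _) hint)
  · simpa [max_eq_right hα] using hint

theorem IsDiagonalizedBy.one_notMem_scaledExpSpectrum_iff
    (hA : IsDiagonalizedBy A e fun i => (lam i : 𝕜)) (hlam : Tendsto lam cofinite atBot)
    (T b : ℝ) :
    (1 : 𝕜) ∉ scaledExpSpectrum A T b ↔ ∀ i, 1 ≠ b * Real.exp (lam i * T) := by
  have hexp (i : ι) :
      NormedSpace.exp ((T : 𝕜) * (lam i : 𝕜)) = ((Real.exp (lam i * T) : ℝ) : 𝕜) := by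
    rw [← RCLike.ofReal_mul, mul_comm T, Real.exp_eq_exp_ℝ]
    exact (NormedSpace.map_exp (RCLike.ofRealAm (K := 𝕜)) RCLike.continuous_ofReal _).symm
  rw [scaledExpSpectrum, hA.spectrum_eq_range hlam, ← range_comp, mem_range, not_exists]
  refine forall_congr' fun i => not_congr ?_
  rw [Function.comp_apply, hexp, ← RCLike.ofReal_mul, ← RCLike.ofReal_one, RCLike.ofReal_inj,
    eq_comm]

theorem IsDiagonalizedBy.one_notMem_scaledExpSpectrum
    (hA : IsDiagonalizedBy A e fun i => (lam i : 𝕜)) (hlam : Tendsto lam cofinite atBot)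
    (hneg : ∀ i, lam i < 0) {T b : ℝ} (hT : 0 < T) (hb : b ≤ 1) :
    (1 : 𝕜) ∉ scaledExpSpectrum A T b := by
  refine (hA.one_notMem_scaledExpSpectrum_iff hlam T b).2 fun i => ne_of_gt ?_
  calc b * Real.exp (lam i * T) ≤ 1 * Real.exp (lam i * T) := by gcongr
    _ < 1 := by
      rw [one_mul, Real.exp_lt_one_iff]
      exact mul_neg_of_neg_of_pos (hneg i) hT

theorem IsDiagonalizedBy.neg_one_notMem_pointSpectrum_iff [CompleteSpace E]
    (hA : IsDiagonalizedBy A e fun i => (lam i : 𝕜)) (hlam : ∀ i, lam i ≤ α) {T : ℝ} (hT : 0 ≤ T)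
    {b : ℝ → ℝ} (hb : IntervalIntegrable b volume 0 T) :
    (-1 : 𝕜) ∉ pointSpectrum (averagedSemigroup A T b) ↔
      ∀ i, -1 ≠ ∫ t in (0 : ℝ)..T, b t * Real.exp (lam i * t) := by
  rw [(hA.isDiagonal_averagedSemigroup hlam hT hb).pointSpectrum_eq_range, mem_range, not_exists]
  refine forall_congr' fun i => not_congr ?_
  rw [← RCLike.ofReal_one, ← RCLike.ofReal_neg, RCLike.ofReal_inj, eq_comm]

theorem IsDiagonalizedBy.neg_one_notMem_pointSpectrum_of_nonneg [CompleteSpace E]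
    (hA : IsDiagonalizedBy A e fun i => (lam i : 𝕜)) (hlam : ∀ i, lam i ≤ α) {T : ℝ} (hT : 0 ≤ T)
    {b : ℝ → ℝ} (hb : IntervalIntegrable b volume 0 T) (hb0 : ∀ t ∈ Icc 0 T, 0 ≤ b t) :
    (-1 : 𝕜) ∉ pointSpectrum (averagedSemigroup A T b) :=
  (hA.neg_one_notMem_pointSpectrum_iff hlam hT hb).2 fun _ =>
    (neg_one_lt_zero.trans_le (intervalIntegral.integral_nonneg hT fun t ht =>
      mul_nonneg (hb0 t ht) (Real.exp_pos _).le)).ne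

end Spectral

theorem isFormalAdjoint_of_isSelfAdjoint [CompleteSpace E] {A : E →ₗ.[𝕜] E}
    (hA : IsSelfAdjoint A) : A.IsFormalAdjoint A := by
  simpa only [LinearPMap.isSelfAdjoint_def.1 hA] using
    LinearPMap.adjoint_isFormalAdjoint hA.dense_domain

theorem integral_pos_of_pos_left {b : ℝ → ℝ} {r s : ℝ} (hrs : r < s)
    (hb : ContinuousOn b (Icc r s)) (hb0 : ∀ t ∈ Icc r s, 0 ≤ b t) (hr : 0 < b r) :
    0 < ∫ t in r..s, b t :=
  intervalIntegral.integral_pos hrs hb (fun t ht => hb0 t (Ioc_subset_Icc_self ht))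
    ⟨r, left_mem_Icc.2 hrs.le, hr⟩

end NonlocalEvolution

theorem proposition2_general {𝕜 E : Type*} [RCLike 𝕜] [NormedAddCommGroup E]
    [InnerProductSpace 𝕜 E] [CompleteSpace E] (A : E →ₗ.[𝕜] E) (hA : A.IsFormalAdjoint A) (α : ℝ)
    (hα : NonlocalEvolution.BoundedAboveBy A α) (hcomp : NonlocalEvolution.HasCompactResolvent A)
    (T : ℝ) (hT : 0 < T) :
    (NonlocalEvolution.IsC0Semigroup (NonlocalEvolution.opExp A) ∧
      NonlocalEvolution.IsGenerator A (NonlocalEvolution.opExp A)) ∧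
    (∀ b : ℝ → ℝ, IntervalIntegrable b volume 0 T →
      IntervalIntegrable (fun t => ((b t : ℝ) : 𝕜) • NonlocalEvolution.opExp A t) volume 0 T) ∧
    (∃ (N : ℕ∞) (lam : {j : ℕ // (j : ℕ∞) < N} → ℝ),
      NonlocalEvolution.IsEigenvalueEnumeration A N lam) ∧
    ∀ (N : ℕ∞) (lam : {j : ℕ // (j : ℕ∞) < N} → ℝ),
      NonlocalEvolution.IsEigenvalueEnumeration A N lam →
      ((∀ j, lam j ≤ α) ∧
        NonlocalEvolution.spectrum A = range fun j => ((lam j : ℝ) : 𝕜)) ∧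
      (∀ (a : ℝ) (b : ℝ → ℝ), IntervalIntegrable b volume 0 T →
        ((LinearMap.ker (NonlocalEvolution.Phi A T a b : E →ₗ[𝕜] E) = ⊥ ↔
          ∀ j, -a ≠ ∫ t in (0 : ℝ)..T, b t * Real.exp (-lam j * (T - t))) ∧
        ((∀ t ∈ Icc 0 T, 0 ≤ b t) →
          ((0 ≤ a ∧ 0 < ∫ t in (0 : ℝ)..T, b t) ∨ (α ≤ 0 ∧ -a < ∫ t in (0 : ℝ)..T, b t)) →
          LinearMap.ker (NonlocalEvolution.Phi A T a b : E →ₗ[𝕜] E) = ⊥))) ∧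
      (∀ b : ℝ,
        (((1 : 𝕜) ∉ NonlocalEvolution.scaledExpSpectrum A T b ↔
          ∀ j, 1 ≠ b * Real.exp (lam j * T)) ∧
        (b ≤ 1 → α < 0 → (1 : 𝕜) ∉ NonlocalEvolution.scaledExpSpectrum A T b))) ∧
      (∀ b : ℝ → ℝ, IntervalIntegrable b volume 0 T →
        (((-1 : 𝕜) ∉ NonlocalEvolution.pointSpectrum
            (NonlocalEvolution.averagedSemigroup A T b) ↔
          ∀ j, -1 ≠ ∫ t in (0 : ℝ)..T, b t * Real.exp (lam j * t)) ∧
        ((∀ t ∈ Icc 0 T, 0 ≤ b t) →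
          (-1 : 𝕜) ∉ NonlocalEvolution.pointSpectrum
            (NonlocalEvolution.averagedSemigroup A T b)))) := by
  obtain ⟨s, e, l, hdiag, hlim⟩ := NonlocalEvolution.exists_isDiagonalizedBy hA hα hcomp
  have hle : ∀ i, l i ≤ α := hdiag.le_of_boundedAboveBy hα
  refine ⟨hdiag.isC0Semigroup_and_isGenerator_opExp hle,
    fun b hb => (hdiag.isDiagonalSemigroup_opExp hle).intervalIntegrable hle hT.le hb,
    hdiag.exists_isEigenvalueEnumeration hlim, fun N lam hlam => ?_⟩
  have hrange : range l = range lam := (hdiag.range_eq_of_isEigenvalueEnumeration hlam).symm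
  have hforall (P : ℝ → Prop) : (∀ i, P (l i)) ↔ ∀ j, P (lam j) := by
    rw [← forall_mem_range, hrange, forall_mem_range]
  have hspec : range (fun i => (l i : 𝕜)) = range fun j => (lam j : 𝕜) := by
    simpa only [← range_comp, Function.comp_def] using congrArg (image ((↑) : ℝ → 𝕜)) hrange
  exact ⟨⟨(hforall (· ≤ α)).1 hle, (hdiag.spectrum_eq_range hlim).trans hspec⟩,
    fun a b hb => ⟨(hdiag.ker_Phi_eq_bot_iff hle hT.le a hb).trans
      (hforall fun r => -a ≠ ∫ t in (0 : ℝ)..T, b t * Real.exp (-r * (T - t))),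
      hdiag.ker_Phi_eq_bot_of_nonneg hle hT.le hb⟩,
    fun b => ⟨(hdiag.one_notMem_scaledExpSpectrum_iff hlim T b).trans
      (hforall fun r => 1 ≠ b * Real.exp (r * T)),
      fun hb hα0 => hdiag.one_notMem_scaledExpSpectrum hlim (fun i => (hle i).trans_lt hα0) hT hb⟩,
    fun b hb => ⟨(hdiag.neg_one_notMem_pointSpectrum_iff hle hT.le hb).trans
      (hforall fun r => -1 ≠ ∫ t in (0 : ℝ)..T, b t * Real.exp (r * t)),
      hdiag.neg_one_notMem_pointSpectrum_of_nonneg hle hT.le hb⟩⟩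

theorem proposition2 {𝕜 E : Type*} [RCLike 𝕜] [NormedAddCommGroup E] [InnerProductSpace 𝕜 E]
    [CompleteSpace E] (A : E →ₗ.[𝕜] E) (hdense : Dense (A.domain : Set E)) (hclosed : A.IsClosed)
    (hA : IsSelfAdjoint A) (α : ℝ) (hα : NonlocalEvolution.BoundedAboveBy A α)
    (hcomp : NonlocalEvolution.HasCompactResolvent A) (T : ℝ) (hT : 0 < T) :
    -- the objects in the statement exist: the semigroup generated by `A`, the operator-valued
    -- integrals, and the list of the eigenvalues (bounded by `α`, exhausting the spectrum)
    (NonlocalEvolution.IsC0Semigroup (NonlocalEvolution.opExp A) ∧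
      NonlocalEvolution.IsGenerator A (NonlocalEvolution.opExp A)) ∧
    (∀ b : ℝ → ℝ, ContinuousOn b (Set.Icc 0 T) →
      IntervalIntegrable (fun t => ((b t : ℝ) : 𝕜) • NonlocalEvolution.opExp A t)
        MeasureTheory.volume 0 T) ∧
    (∃ (N : ℕ∞) (lam : {j : ℕ // (j : ℕ∞) < N} → ℝ),
      NonlocalEvolution.IsEigenvalueEnumeration A N lam) ∧
    ∀ (N : ℕ∞) (lam : {j : ℕ // (j : ℕ∞) < N} → ℝ),
      NonlocalEvolution.IsEigenvalueEnumeration A N lam →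
      ((∀ j, lam j ≤ α) ∧
        NonlocalEvolution.spectrum A = Set.range fun j => ((lam j : ℝ) : 𝕜)) ∧
      -- (a)
      (∀ (a : ℝ) (b : ℝ → ℝ), ContinuousOn b (Set.Icc 0 T) →
        ((LinearMap.ker (NonlocalEvolution.Phi A T a b : E →ₗ[𝕜] E) = ⊥ ↔
          ∀ j, -a ≠ ∫ t in (0 : ℝ)..T, b t * Real.exp (-lam j * (T - t))) ∧
        ((∀ t ∈ Set.Icc 0 T, 0 ≤ b t) →
          ((0 ≤ a ∧ 0 < b 0) ∨ (α ≤ 0 ∧ -a < ∫ t in (0 : ℝ)..T, b t)) →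
          LinearMap.ker (NonlocalEvolution.Phi A T a b : E →ₗ[𝕜] E) = ⊥))) ∧
      -- (b)
      (∀ b : ℝ, b ≠ 0 →
        (((1 : 𝕜) ∉ NonlocalEvolution.scaledExpSpectrum A T b ↔
          ∀ j, 1 ≠ b * Real.exp (lam j * T)) ∧
        (b ≤ 1 → α < 0 → (1 : 𝕜) ∉ NonlocalEvolution.scaledExpSpectrum A T b))) ∧
      -- (c)
      (∀ b : ℝ → ℝ, ContinuousOn b (Set.Icc 0 T) →
        (((-1 : 𝕜) ∉ NonlocalEvolution.pointSpectrum
            (NonlocalEvolution.averagedSemigroup A T b) ↔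
          ∀ j, -1 ≠ ∫ t in (0 : ℝ)..T, b t * Real.exp (lam j * t)) ∧
        ((∀ t ∈ Set.Icc 0 T, 0 ≤ b t) →
          (-1 : 𝕜) ∉ NonlocalEvolution.pointSpectrum
            (NonlocalEvolution.averagedSemigroup A T b)))) := by
  have hL {b : ℝ → ℝ} (hb : ContinuousOn b (Icc 0 T)) : IntervalIntegrable b volume 0 T :=
    hb.intervalIntegrable_of_Icc hT.le
  obtain ⟨hgen, hint, hlist, h⟩ := proposition2_general A
    (NonlocalEvolution.isFormalAdjoint_of_isSelfAdjoint hA) α hα hcomp T hT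
  refine ⟨hgen, fun b hb => hint b (hL hb), hlist, fun N lam hlam => ?_⟩
  obtain ⟨hspec, hPhi, hexp, hpoint⟩ := h N lam hlam
  exact ⟨hspec, fun a b hb => ⟨(hPhi a b (hL hb)).1, fun hb0 hab => (hPhi a b (hL hb)).2 hb0 <|
      hab.imp_left <| .imp_right <| NonlocalEvolution.integral_pos_of_pos_left hT hb hb0⟩,
    fun b _ => hexp b, fun b hb => hpoint b (hL hb)⟩
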